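/- Graphs are finite, simple and undirected; a graph is trivial if it has exactly one vertex. For distinct vertices $x,y$ of $G$ let $p(x,y)$ be the maximum number of pairwise internally disjoint $(x,y)$-paths. A graph $G$ with at least two vertices is $k$-connected if $p(x,y)\ge k$ for all distinct vertices $x,y$, and its connectivity $\kappa(G)$ is the largest $k$ for which $G$ is $k$-connected. A $K_{1,2}$-structure-cut of $G$ is a set $\mathcal F$ of pairwise vertex-disjoint subgraphs of $G$, each isomorphic to $K_{1,2}$, such that $G-V(\mathcal F)$ is disconnected or trivial (the graph without vertices counts as neither), where $V(\mathcal F)$ is the union of the vertex sets of the members of $\mathcal F$. If $G$ has a $K_{1,2}$-structure-cut, $\kappa(G;K_{1,2})$ denotes the minimum cardinality of one. **Theorem.** Let $G$ be a connected graph with $n\ge 4$ vertices. If $G$ has a $K_{1,2}$-structure-cut, then $$\frac{\kappa(G)}{3}\le \kappa(G;K_{1,2})\le \kappa(G).$$ Both bounds are sharp: there is a connected graph $G$ with at least $4$ vertices that has a $K_{1,2}$-structure-cut and satisfies $\kappa(G;K_{1,2})=\kappa(G)/3$; and for every $n\ge 7$ the cycle $C_n$ has a $K_{1,2}$-structure-cut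 and $\kappa(C_n;K_{1,2})=\kappa(C_n)=2$. -/

import Mathlib

namespace SimpleGraph

/-- Two `(x, y)`-paths are internally disjoint if they have no internal vertex in common. -/
def InternallyDisjoint {V : Type*} {G : SimpleGraph V} {x y : V} (p q : G.Path x y) : Prop :=
  ∀ v : V, v ∈ p.1.support → v ∈ q.1.support → v = x ∨ v = y

/-- The local connectivity `p(x, y)`, for distinct vertices `x, y` of a finite graph: the maximum
number of pairwise internally disjoint `(x, y)`-paths. -/
noncomputable def localConnectivity {V : Type*} (G : SimpleGraph V) (x y : V) : ℕ :=
  sSup {k : ℕ | ∃ P : Finset (G.Path x y),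
    (P : Set (G.Path x y)).Pairwise InternallyDisjoint ∧ P.card = k}

/-- A nontrivial graph is `k`-connected if `k ≤ p(u, v)` for any two distinct vertices. -/
def IsVertexConnected {V : Type*} (G : SimpleGraph V) (k : ℕ) : Prop :=
  Nontrivial V ∧ ∀ u v : V, u ≠ v → k ≤ G.localConnectivity u v

/-- The connectivity `κ(G)` of a finite nontrivial graph: the maximum `k` for which `G` is
`k`-connected. -/
noncomputable def vertexConnectivity {V : Type*} (G : SimpleGraph V) : ℕ :=
  sSup {k : ℕ | G.IsVertexConnected k}

/-- `G - V(F)` is disconnected, or trivial (it has exactly one vertex), for a set `F` of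
vertex-disjoint connected subgraphs of `G`. The graph without vertices is neither
disconnected nor trivial. -/
def IsSubgraphCut {V : Type*} (G : SimpleGraph V) (F : Finset G.Subgraph) : Prop :=
  (∀ K ∈ F, K.Connected) ∧
  (F : Set G.Subgraph).PairwiseDisjoint Subgraph.verts ∧
  (¬ (G.induce (⋃ K ∈ F, K.verts)ᶜ).Preconnected ∨ (⋃ K ∈ F, K.verts)ᶜ.ncard = 1)

/-- An `H`-structure-cut: a subgraph-cut all of whose elements are isomorphic to `H`. -/
def IsStructureCut {V W : Type*} (G : SimpleGraph V) (H : SimpleGraph W)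
    (F : Finset G.Subgraph) : Prop :=
  G.IsSubgraphCut F ∧ ∀ K ∈ F, Nonempty (K.coe ≃g H)

/-- The `H`-structure-connectivity `κ(G; H)`: the minimum cardinality of an `H`-structure-cut
(meaningful when there is one). -/
noncomputable def structureConnectivity {V W : Type*} (G : SimpleGraph V)
    (H : SimpleGraph W) : ℕ :=
  sInf {k : ℕ | ∃ F : Finset G.Subgraph, G.IsStructureCut H F ∧ F.card = k}

/-- The complete bipartite graph `K_{1,2}`. -/
abbrev K12 : SimpleGraph (Fin 1 ⊕ Fin 2) := completeBipartiteGraph (Fin 1) (Fin 2)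

end SimpleGraph

/-!
The lower bound is the easy direction of Whitney's theorem: the `3m` vertices of a
`K_{1,2}`-structure-cut with `m` elements meet every path between two vertices that they separate,
and if they leave only one vertex, then `κ(G) ≤ |V| - 1 = 3m`
(`vertexConnectivity_le_three_mul_structureConnectivity`).

For the upper bound, let `k = κ(G)`. Any structure-cut leaves a vertex over and thus has at most
`(|V| - 1) / 3` elements, so only the case `|V| ≥ 3k + 4` matters. There the connectivity, which is
defined by disjoint paths, has to be turned into a separating set with at most `k` vertices. This is
Menger's theorem; it is proved for digraphs by Göring's induction on the arcs
(`hasLinkage_of_forall_arcSeparates`), with digraphs given by finite sets of arcs and paths by lists,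
and then applied to the neighbourhoods of two vertices, adjacent or not
(`exists_isSeparation_of_localConnectivity_le`).

Given a separation with parts `A`, `B` and separator `S`, where `|A| + |B| ≥ 2|S| + 2`, induction
on `|S|` yields at most `|S|` disjoint copies of `K_{1,2}` whose removal leaves two nonempty parts
without edges between them (`IsSeparation.exists_K12_packing`). Fix `s ∈ S`. If `s` has no neighbour
in one of `A` and `B`, it can be moved from `S` to the other part. Otherwise a path `a - s - b`
through both parts can be removed, unless one part, say `A`, is a single vertex; then `B` has at
least three vertices, and a path on three vertices of `B ∪ S` through `s` can be removed, unless the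
only neighbour of `s` in `B` is isolated in `B`, in which case it can be moved to `A` together
with `s`. The parameter `|S|` drops by at least one each time, and no connectivity assumption has to
be carried along.

The lower bound is attained by `K_5` without an edge, where `κ = 3`. In a cycle, removing one vertex
or one copy of `K_{1,2}` leaves a path, so both parameters are at least two.
-/

namespace SimpleGraph

/-! ### Menger's theorem for digraphs -/

section Menger

variable {V : Type*}

/-- `S` separates `A` from `B` in the digraph with arc set `E`. The witness `R` is a set of vertices
that contains `A \ S`, that arcs leave only into `S`, and that meets `B` only in `S`. -/
def ArcSeparates (E : Finset (V × V)) (A B S : Finset V) : Prop :=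
  ∃ R : Set V, (∀ a ∈ A, a ∉ S → a ∈ R) ∧ (∀ a b, (a, b) ∈ E → a ∈ R → b ∈ R ∨ b ∈ S) ∧
    ∀ b ∈ B, b ∈ R → b ∈ S

/-- `l` is the vertex sequence of a directed path from `A` to `B` in the digraph with arc
set `E`. -/
def IsArcPath (E : Finset (V × V)) (A B : Finset V) (l : List V) : Prop :=
  l.IsChain (fun a b => (a, b) ∈ E) ∧ l.Nodup ∧ (∃ a ∈ A, l.head? = some a) ∧
    ∃ b ∈ B, l.getLast? = some b

/-- The digraph with arc set `E` contains `k` pairwise disjoint paths from `A` to `B`. The paths are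
indexed by `k` elements of `V`, so that they can be indexed by their ends. -/
def HasLinkage (E : Finset (V × V)) (A B : Finset V) (k : ℕ) : Prop :=
  ∃ (I : Finset V) (p : V → List V), I.card = k ∧ (∀ i ∈ I, IsArcPath E A B (p i)) ∧
    ∀ i ∈ I, ∀ j ∈ I, i ≠ j → (p i).Disjoint (p j)

/-- A separator meets every walk from `A` to `B`, not only the paths. -/
theorem ArcSeparates.exists_mem {E : Finset (V × V)} {A B S : Finset V}
    (h : ArcSeparates E A B S) {l : List V} (hl : l.IsChain fun a b => (a, b) ∈ E)
    {a b : V} (ha : a ∈ A) (hla : l.head? = some a) (hb : b ∈ B) (hlb : l.getLast? = some b) :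
    ∃ s ∈ S, s ∈ l := by
  obtain ⟨R, hA, hE, hB⟩ := h
  by_contra! hS
  have key : ∀ (l : List V) (a : V), l.IsChain (fun a b => (a, b) ∈ E) → (∀ s ∈ S, s ∉ l) →
      l.head? = some a → a ∈ R → l.getLast? = some b → b ∈ R := by
    intro l
    induction l with
    | nil => simp
    | cons x l ih =>
      intro a hl hS hx ha hb
      cases l with
      | nil => simp_all
      | cons y l =>
        have hy : y ∉ S := fun h => hS y h (by simp)
        simp only [List.head?_cons, Option.some.injEq] at hx
        subst hx
        rw [List.isChain_cons_cons] at hl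
        refine ih y hl.2 (fun s hs h => hS s hs (List.mem_cons_of_mem _ h)) rfl ?_ (by simpa using hb)
        exact (hE _ _ hl.1 ha).resolve_right hy
  have haS : a ∉ S := fun h => hS a h (List.mem_of_mem_head? (by simp [hla]))
  have hbR := key l a hl hS hla (hA a ha haS) hlb
  exact hS b (hB b hb hbR) (List.mem_of_mem_getLast? (by simp [hlb]))

/-- Disjoint paths from `A` to a set `P` that is not larger than their number end at all vertices of
`P`, and can be indexed by their ends. -/
theorem HasLinkage.index_by_last {E : Finset (V × V)} {A P : Finset V} {k : ℕ}
    (h : HasLinkage E A P k) (hP : P.card ≤ k) :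
    P.card = k ∧ ∃ p : V → List V,
      (∀ v ∈ P, (p v ++ [v]).IsChain (fun a b => (a, b) ∈ E) ∧ (p v ++ [v]).Nodup ∧
        ∃ a ∈ A, (p v ++ [v]).head? = some a) ∧
      ∀ v ∈ P, ∀ w ∈ P, v ≠ w → (p v ++ [v]).Disjoint (p w ++ [w]) := by
  obtain ⟨I, p, rfl, hp, hd⟩ := h
  choose! f hfP hf using fun i hi => (hp i hi).2.2.2
  have hinj : ∀ i ∈ I, ∀ j ∈ I, f i = f j → i = j := by
    intro i hi j hj hij
    by_contra hne
    exact hd i hi j hj hne (List.mem_of_mem_getLast? (a := f i) (by simp [hf i hi]))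
      (List.mem_of_mem_getLast? (by simp [hf j hj, hij]))
  have hcard : P.card = I.card :=
    le_antisymm hP (Finset.card_le_card_of_injOn f hfP (fun i hi j hj => hinj i hi j hj))
  have hsurj := Finset.surj_on_of_inj_on_of_card_le (s := I) (t := P) (fun i _ => f i) hfP
    (fun i j hi hj => hinj i hi j hj) hP
  choose! g hg hgf using hsurj
  have heq : ∀ v ∈ P, (p (g v)).dropLast ++ [v] = p (g v) := by
    intro v hv
    refine List.dropLast_append_getLast? _ ?_
    simpa [← hgf v hv] using hf (g v) (hg v hv)
  refine ⟨hcard, fun v => (p (g v)).dropLast, fun v hv => ?_, fun v hv w hw hvw => ?_⟩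
  · have := hp _ (hg v hv)
    simp only [heq v hv]
    exact ⟨this.1, this.2.1, this.2.2.1⟩
  · simp only [heq v hv, heq w hw]
    exact hd _ (hg v hv) _ (hg w hw) fun h => hvw (by rw [hgf v hv, hgf w hw, h])

/-- Disjoint paths to `B` from a set `Q` that is not larger than their number start at all vertices
of `Q`, and can be indexed by their starts. -/
theorem HasLinkage.index_by_head {E : Finset (V × V)} {Q B : Finset V} {k : ℕ}
    (h : HasLinkage E Q B k) (hQ : Q.card ≤ k) :
    Q.card = k ∧ ∃ q : V → List V,
      (∀ v ∈ Q, (v :: q v).IsChain (fun a b => (a, b) ∈ E) ∧ (v :: q v).Nodup ∧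
        ∃ b ∈ B, (v :: q v).getLast? = some b) ∧
      ∀ v ∈ Q, ∀ w ∈ Q, v ≠ w → (v :: q v).Disjoint (w :: q w) := by
  obtain ⟨I, p, rfl, hp, hd⟩ := h
  choose! f hfQ hf using fun i hi => (hp i hi).2.2.1
  have hinj : ∀ i ∈ I, ∀ j ∈ I, f i = f j → i = j := by
    intro i hi j hj hij
    by_contra hne
    exact hd i hi j hj hne (List.mem_of_mem_head? (a := f i) (by simp [hf i hi]))
      (List.mem_of_mem_head? (by simp [hf j hj, hij]))
  have hcard : Q.card = I.card :=
    le_antisymm hQ (Finset.card_le_card_of_injOn f hfQ (fun i hi j hj => hinj i hi j hj))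
  have hsurj := Finset.surj_on_of_inj_on_of_card_le (s := I) (t := Q) (fun i _ => f i) hfQ
    (fun i j hi hj => hinj i hi j hj) hQ
  choose! g hg hgf using hsurj
  have heq : ∀ v ∈ Q, v :: (p (g v)).tail = p (g v) := by
    intro v hv
    refine List.cons_head?_tail ?_
    simpa [← hgf v hv] using hf (g v) (hg v hv)
  refine ⟨hcard, fun v => (p (g v)).tail, fun v hv => ?_, fun v hv w hw hvw => ?_⟩
  · have := hp _ (hg v hv)
    simp only [heq v hv]
    exact ⟨this.1, this.2.1, this.2.2.2⟩
  · simp only [heq v hv, heq w hw]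
    exact hd _ (hg v hv) _ (hg w hw) fun h => hvw (by rw [hgf v hv, hgf w hw, h])

theorem HasLinkage.mono {E E' : Finset (V × V)} {A B : Finset V} {k : ℕ}
    (h : HasLinkage E A B k) (hE : E ⊆ E') : HasLinkage E' A B k := by
  obtain ⟨I, p, hI, hp, hd⟩ := h
  exact ⟨I, p, hI, fun i hi => ⟨(hp i hi).1.imp fun _ _ h => hE h, (hp i hi).2⟩, hd⟩

/-- Paths from `A` to `P ⊇ S` and from `Q ⊇ S` to `B`, where `S` separates `A` from `B`, meet only in
common ends that lie in `S`. -/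
theorem ArcSeparates.eq_of_mem_of_mem {E : Finset (V × V)} {A B S P Q : Finset V}
    (hS : ArcSeparates E A B S) (hSP : S ⊆ P) (hSQ : S ⊆ Q) {p q : V → List V}
    (hp : ∀ v ∈ P, (p v ++ [v]).IsChain (fun a b => (a, b) ∈ E) ∧ (p v ++ [v]).Nodup ∧
        ∃ a ∈ A, (p v ++ [v]).head? = some a)
    (hpd : ∀ v ∈ P, ∀ w ∈ P, v ≠ w → (p v ++ [v]).Disjoint (p w ++ [w]))
    (hq : ∀ v ∈ Q, (v :: q v).IsChain (fun a b => (a, b) ∈ E) ∧ (v :: q v).Nodup ∧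
        ∃ b ∈ B, (v :: q v).getLast? = some b)
    (hqd : ∀ v ∈ Q, ∀ w ∈ Q, v ≠ w → (v :: q v).Disjoint (w :: q w))
    {v w z : V} (hv : v ∈ P) (hw : w ∈ Q) (hzp : z ∈ p v ++ [v]) (hzq : z ∈ w :: q w) :
    z ∈ S ∧ z = v ∧ z = w := by
  obtain ⟨hpc, hpn, a, ha, hpa⟩ := hp v hv
  obtain ⟨hqc, hqn, b, hb, hqb⟩ := hq w hw
  obtain ⟨l₁, l₂, hl⟩ := List.append_of_mem hzp
  obtain ⟨m₁, m₂, hm⟩ := List.append_of_mem hzq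
  -- Switching at `z` from the first path to the second gives a walk from `A` to `B`.
  have hc : (l₁ ++ z :: m₂).IsChain fun a b => (a, b) ∈ E := by
    rw [List.isChain_split]
    rw [hl, List.isChain_split] at hpc
    rw [hm, List.isChain_split] at hqc
    exact ⟨hpc.1, hqc.2⟩
  obtain ⟨s, hsS, hs⟩ := hS.exists_mem hc ha (by rw [← hpa, hl]; cases l₁ <;> simp) hb
    (by rw [← hqb, hm]; simp [List.getLast?_append, List.getLast?_cons])
  have hself : ∀ t ∈ P, t ∈ p v ++ [v] → t = v := by
    intro t ht htv
    by_contra hne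
    exact hpd t ht v hv hne (by simp) htv
  have hself' : ∀ t ∈ Q, t ∈ w :: q w → t = w := by
    intro t ht htw
    by_contra hne
    exact hqd t ht w hw hne (by simp) htw
  have hzS : z ∈ S := by
    rcases List.mem_append.1 hs with h | h
    · obtain rfl := hself s (hSP hsS) (by simp [hl, h])
      have hlast : s ∈ z :: l₂ := by
        refine List.mem_of_mem_getLast? ?_
        have := congrArg List.getLast? hl
        simpa [List.getLast?_append, List.getLast?_cons, eq_comm] using this
      rw [hl, List.nodup_append] at hpn
      exact absurd rfl (hpn.2.2 s h s hlast)
    · rcases List.mem_cons.1 h with h | h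
      · exact h ▸ hsS
      · obtain rfl := hself' s (hSQ hsS) (by simp [hm, h])
        rw [List.append_cons] at hm
        have hhead : s ∈ m₁ ++ [z] := by
          refine List.mem_of_mem_head? ?_
          have := congrArg List.head? hm
          simp only [List.head?_append, List.head?_cons] at this ⊢
          cases m₁ <;> simp_all
        rw [hm, List.nodup_append] at hqn
        exact absurd rfl (hqn.2.2 s hhead s h)
  exact ⟨hzS, hself z (hSP hzS) hzp, hself' z (hSQ hzS) hzq⟩

/-- A separator of `A` from `S ∪ {x}` in `E` separates `A` from `B` after the arc `(x, y)` has
been added, if `S` separates `A` from `B` in `E`. -/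
theorem ArcSeparates.insert_left [DecidableEq V] {E : Finset (V × V)} {A B S T : Finset V} {x y : V}
    (hS : ArcSeparates E A B S) (hT : ArcSeparates E A (insert x S) T) :
    ArcSeparates (insert (x, y) E) A B T := by
  obtain ⟨R₁, hA₁, hE₁, hB₁⟩ := hS
  obtain ⟨R₂, hA₂, hE₂, hP₂⟩ := hT
  have hP : ∀ v ∈ R₂, v ∈ insert x S → v ∈ T := fun v hv hvP => hP₂ v hvP hv
  refine ⟨(R₁ ∩ R₂) \ T, ?_, ?_, ?_⟩
  · intro a ha haT
    have := hA₁ a ha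
    have := hA₂ a ha haT
    grind
  · rintro a b hab ⟨⟨h₁, h₂⟩, hT⟩
    have hax : a ≠ x := by
      rintro rfl
      exact hT (hP a h₂ (by simp))
    have habE : (a, b) ∈ E := by simpa [hax] using hab
    have := hE₁ a b habE h₁
    have := hE₂ a b habE h₂
    grind
  · rintro b hb ⟨⟨h₁, h₂⟩, hT⟩
    exact hP b h₂ (by simp [hB₁ b hb h₁])

/-- A separator of `S ∪ {y}` from `B` in `E` separates `A` from `B` after the arc `(x, y)` has
been added, if `S` separates `A` from `B` in `E`. -/
theorem ArcSeparates.insert_right [DecidableEq V] {E : Finset (V × V)} {A B S T : Finset V} {x y : V}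
    (hS : ArcSeparates E A B S) (hT : ArcSeparates E (insert y S) B T) :
    ArcSeparates (insert (x, y) E) A B T := by
  obtain ⟨R₁, hA₁, hE₁, hB₁⟩ := hS
  obtain ⟨R₂, hQ₂, hE₂, hB₂⟩ := hT
  have hQ : ∀ v ∈ insert y S, v ∈ R₂ ∨ v ∈ T := fun v hv => by
    by_cases h : v ∈ T
    · exact Or.inr h
    · exact Or.inl (hQ₂ v hv h)
  refine ⟨R₁ ∪ R₂, ?_, ?_, ?_⟩
  · intro a ha haT
    have := hA₁ a ha
    have := hQ a
    grind
  · intro a b hab hR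
    by_cases hby : b = y
    · have := hQ b (by simp [hby])
      grind
    · have habE : (a, b) ∈ E := by simpa [hby] using hab
      have := hE₁ a b habE
      have := hE₂ a b habE
      have := hQ b
      grind
  · rintro b hb (h₁ | h₂)
    · have := hQ b (by simp [hB₁ b hb h₁])
      have := hB₂ b hb
      grind
    · exact hB₂ b hb h₂

/-- Menger's theorem for digraphs: if every set that separates `A` from `B` has at least `k`
elements, then there are `k` pairwise disjoint paths from `A` to `B`. -/
theorem hasLinkage_of_forall_arcSeparates (E : Finset (V × V)) :
    ∀ (A B : Finset V) (k : ℕ), (∀ S, ArcSeparates E A B S → k ≤ S.card) → HasLinkage E A B k := by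
  classical
  induction E using Finset.induction_on with
  | empty =>
    intro A B k h
    have hk := h (A ∩ B) ⟨{a | a ∉ B}, by simp +contextual, by simp, by simp +contextual⟩
    obtain ⟨I, hI, hIk⟩ := Finset.exists_subset_card_eq hk
    refine ⟨I, fun v => [v], hIk, fun i hi => ?_, fun i _ j _ hij => by simpa [eq_comm] using hij⟩
    have := Finset.mem_inter.1 (hI hi)
    exact ⟨by simp, by simp, ⟨i, this.1, rfl⟩, ⟨i, this.2, rfl⟩⟩
  | insert e E _ ih =>
    obtain ⟨x, y⟩ := e
    intro A B k h
    by_cases hE : ∀ S, ArcSeparates E A B S → k ≤ S.card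
    · exact (ih A B k hE).mono (Finset.subset_insert _ _)
    push Not at hE
    obtain ⟨S, hS, hSk⟩ := hE
    have hcard : ∀ v, (insert v S).card ≤ k := fun v => (Finset.card_insert_le _ _).trans hSk
    -- `S` is too small to separate `A` from `B` in the larger digraph, so `S ∪ {x}` can be reached
    -- from `A`, and `B` from `S ∪ {y}`, by `k` disjoint paths each.
    obtain ⟨hPk, p, hp, hpd⟩ :=
      (ih A (insert x S) k fun T hT => h T (hS.insert_left hT)).index_by_last (hcard x)
    obtain ⟨hQk, q, hq, hqd⟩ :=
      (ih (insert y S) B k fun T hT => h T (hS.insert_right hT)).index_by_head (hcard y)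
    have hmeet := fun {v w z : V} => hS.eq_of_mem_of_mem (v := v) (w := w) (z := z)
      (Finset.subset_insert x S) (Finset.subset_insert y S) hp hpd hq hqd
    have hxS : x ∉ S := fun hx => by
      rw [Finset.insert_eq_of_mem hx] at hPk
      omega
    have hyS : y ∉ S := fun hy => by
      rw [Finset.insert_eq_of_mem hy] at hQk
      omega
    set t : V → List V := fun v => if v = x then y :: q y else q v with ht
    have hSx : ∀ v ∈ insert x S, v ≠ x → v ∈ S := fun v hv hvx =>
      (Finset.mem_insert.1 hv).resolve_left hvx
    -- The second half of the path through `v` lies on the path that starts at `y` or at `v`.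
    have htm : ∀ v ∈ insert x S, ∀ z ∈ t v,
        z ∈ (if v = x then y else v) :: q (if v = x then y else v) := by
      intro v _ z hz
      by_cases hvx : v = x
      · simpa [ht, hvx] using hz
      · simp only [ht, if_neg hvx] at hz ⊢
        exact List.mem_cons_of_mem _ hz
    have hσ : ∀ v ∈ insert x S, (if v = x then y else v) ∈ insert y S := by
      intro v hv
      split_ifs with hvx
      · exact Finset.mem_insert_self _ _
      · exact Finset.mem_insert_of_mem (hSx v hv hvx)
    refine ⟨insert x S, fun v => (p v ++ [v]) ++ t v, hPk, fun v hv => ⟨?_, ?_, ?_, ?_⟩, ?_⟩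
    · have hpc := (hp v hv).1.imp (S := fun a b => (a, b) ∈ insert (x, y) E)
        fun _ _ h => Finset.mem_insert_of_mem h
      by_cases hvx : v = x
      · have hqc := (hq y (by simp)).1.imp (S := fun a b => (a, b) ∈ insert (x, y) E)
          fun _ _ h => Finset.mem_insert_of_mem h
        subst hvx
        simp only [ht, if_true]
        refine List.isChain_append.2 ⟨hpc, hqc, ?_⟩
        simp
      · have hqc := (hq v (by simp [hSx v hv hvx])).1.imp
          (S := fun a b => (a, b) ∈ insert (x, y) E) fun _ _ h => Finset.mem_insert_of_mem h
        simp only [ht, if_neg hvx, List.append_assoc, List.singleton_append]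
        exact List.isChain_split.2 ⟨hpc, hqc⟩
    · have hqn := (hq _ (hσ v hv)).2.1
      refine List.nodup_append.2 ⟨(hp v hv).2.1, ?_, ?_⟩
      · by_cases hvx : v = x
        · simpa [ht, hvx] using hqn
        · simpa [ht, hvx] using (List.nodup_cons.1 hqn).2
      · rintro z hz _ hz' rfl
        obtain ⟨hzS, rfl, -⟩ := hmeet hv (hσ v hv) hz (htm v hv z hz')
        have hzx : z ≠ x := fun h => hxS (h ▸ hzS)
        simp only [if_neg hzx, ht] at hqn hz'
        exact (List.nodup_cons.1 hqn).1 hz'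
    · obtain ⟨a, ha, h⟩ := (hp v hv).2.2
      exact ⟨a, ha, by rw [List.head?_append, h]; rfl⟩
    · obtain ⟨b, hb, h⟩ := (hq _ (hσ v hv)).2.2
      refine ⟨b, hb, ?_⟩
      by_cases hvx : v = x
      · simp only [hvx, if_true] at h
        simp [ht, hvx, List.getLast?_append, h]
      · simp only [hvx, if_false] at h
        simpa [ht, hvx, List.getLast?_append, List.getLast?_cons] using h
    · have hcross : ∀ v ∈ insert x S, ∀ w ∈ insert x S, v ≠ w → ∀ z, z ∈ p v ++ [v] →
          z ∉ t w := by
        intro v hv w hw hvw z hz hz'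
        obtain ⟨hzS, hzv, hzw⟩ := hmeet hv (hσ w hw) hz (htm w hw z hz')
        split_ifs at hzw with hwx
        · exact hyS (hzw ▸ hzS)
        · exact hvw (hzv.symm.trans hzw)
      intro v hv w hw hvw z hz hz'
      rcases List.mem_append.1 hz with h | h <;> rcases List.mem_append.1 hz' with h' | h'
      · exact hpd v hv w hw hvw h h'
      · exact hcross v hv w hw hvw z h h'
      · exact hcross w hw v hv hvw.symm z h' h
      · refine hqd _ (hσ v hv) _ (hσ w hw) ?_ (htm v hv z h) (htm w hw z h')
        have hyw : ∀ u ∈ insert x S, u ≠ x → u ≠ y := fun u hu hux huy =>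
          hyS (huy ▸ hSx u hu hux)
        split_ifs with hvx hwx hwx
        · exact absurd (hvx.trans hwx.symm) hvw
        · exact (hyw w hw hwx).symm
        · exact hyw v hv hvx
        · exact hvw

end Menger

/-! ### Connectivity, local connectivity and separations -/

section Connectivity

variable {V : Type*} {G : SimpleGraph V}

theorem Path.eq_of_forall_mem_support {x y : V} (hxy : x ≠ y) {p q : G.Path x y}
    (hp : ∀ v ∈ p.1.support, v = x ∨ v = y) (hq : ∀ v ∈ q.1.support, v = x ∨ v = y) : p = q := by
  have key : ∀ p : G.Path x y, (∀ v ∈ p.1.support, v = x ∨ v = y) →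
      ∃ h : G.Adj x y, p.1 = .cons h .nil := by
    rintro ⟨p, hp⟩ hv
    cases p with
    | nil => exact absurd rfl hxy
    | @cons _ w _ h p =>
      rw [Walk.cons_isPath_iff] at hp
      rcases hv w (by simp) with rfl | rfl
      · exact absurd h G.irrefl
      · obtain rfl := Walk.eq_nil_iff_nil.2 (Walk.isPath_iff_nil.1 hp.1)
        exact ⟨h, rfl⟩
  obtain ⟨_, h⟩ := key p hp
  obtain ⟨_, h'⟩ := key q hq
  exact Subtype.ext (h.trans h'.symm)

theorem card_le_of_pairwise_internallyDisjoint {x y : V} {P : Finset (G.Path x y)}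
    (hP : (P : Set (G.Path x y)).Pairwise InternallyDisjoint) {S : Finset V}
    (hS : ∀ p ∈ P, ∃ s ∈ S, s ∈ p.1.support ∧ s ≠ x ∧ s ≠ y) : P.card ≤ S.card := by
  have : Nonempty V := ⟨x⟩
  choose! f hfS hfp hfx hfy using hS
  refine Finset.card_le_card_of_injOn f hfS fun p hp q hq hpq => ?_
  by_contra hne
  rcases hP hp hq hne (f p) (hfp p hp) (hpq ▸ hfp q hq) with h | h
  · exact hfx p hp h
  · exact hfy p hp h

/-- The path through the edge between `x` and `y`, if there is one, is counted too, so the bound is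
`|V| - 1` and not `|V| - 2`. -/
theorem card_lt_of_pairwise_internallyDisjoint [Finite V] {x y : V} (hxy : x ≠ y)
    {P : Finset (G.Path x y)} (hP : (P : Set (G.Path x y)).Pairwise InternallyDisjoint) :
    P.card < Nat.card V := by
  classical
  have := Fintype.ofFinite V
  -- Each path is sent to an inner vertex, or to `y` if it has none.
  have hf : ∀ p : G.Path x y, ∃ v ∈ p.1.support, v ≠ x ∧
      (v = y → ∀ w ∈ p.1.support, w = x ∨ w = y) := by
    intro p
    by_cases h : ∀ w ∈ p.1.support, w = x ∨ w = y
    · exact ⟨y, by simp, hxy.symm, fun _ => h⟩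
    · push Not at h
      obtain ⟨w, hw, hwx, hwy⟩ := h
      exact ⟨w, hw, hwx, fun h => absurd h hwy⟩
  choose f hfp hfx hfy using hf
  have hle : P.card ≤ (Finset.univ.erase x).card := by
    refine Finset.card_le_card_of_injOn f (fun p _ => by simp [hfx p]) fun p hp q hq hpq => ?_
    by_contra hne
    have hy : f p = y := (hP hp hq hne (f p) (hfp p) (hpq ▸ hfp q)).resolve_left (hfx p)
    exact hne (Path.eq_of_forall_mem_support hxy (hfy p hy) (hfy q (hpq ▸ hy)))
  rw [Finset.card_erase_of_mem (Finset.mem_univ x), Finset.card_univ] at hle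
  have : 0 < Fintype.card V := Fintype.card_pos_iff.2 ⟨x⟩
  rw [Nat.card_eq_fintype_card]
  omega

theorem localConnectivity_le {x y : V} {m : ℕ}
    (h : ∀ P : Finset (G.Path x y), (P : Set (G.Path x y)).Pairwise InternallyDisjoint →
      P.card ≤ m) : G.localConnectivity x y ≤ m :=
  csSup_le' (by rintro _ ⟨P, hP, rfl⟩; exact h P hP)

theorem card_le_localConnectivity [Finite V] {x y : V} (hxy : x ≠ y) {P : Finset (G.Path x y)}
    (hP : (P : Set (G.Path x y)).Pairwise InternallyDisjoint) :
    P.card ≤ G.localConnectivity x y :=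
  le_csSup ⟨Nat.card V, by
    rintro _ ⟨Q, hQ, rfl⟩
    exact (card_lt_of_pairwise_internallyDisjoint hxy hQ).le⟩ ⟨P, hP, rfl⟩

theorem localConnectivity_lt_card [Finite V] {x y : V} (hxy : x ≠ y) :
    G.localConnectivity x y < Nat.card V := by
  have : Nonempty V := ⟨x⟩
  have hpos : 0 < Nat.card V := Nat.card_pos
  have : G.localConnectivity x y ≤ Nat.card V - 1 := localConnectivity_le fun P hP => by
    have := card_lt_of_pairwise_internallyDisjoint hxy hP
    omega
  omega

section Nontrivial

variable [Finite V] [Nontrivial V] (G)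

theorem bddAbove_isVertexConnected : BddAbove {k : ℕ | G.IsVertexConnected k} := by
  obtain ⟨x, y, hxy⟩ := exists_pair_ne V
  exact ⟨Nat.card V, fun k hk => (hk.2 x y hxy).trans (localConnectivity_lt_card hxy).le⟩

theorem vertexConnectivity_le_localConnectivity {x y : V} (hxy : x ≠ y) :
    G.vertexConnectivity ≤ G.localConnectivity x y :=
  (Nat.sSup_mem (s := {k : ℕ | G.IsVertexConnected k})
    ⟨0, inferInstance, fun _ _ _ => Nat.zero_le _⟩ G.bddAbove_isVertexConnected).2 x y hxy

theorem vertexConnectivity_lt_card : G.vertexConnectivity < Nat.card V := by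
  obtain ⟨x, y, hxy⟩ := exists_pair_ne V
  exact (G.vertexConnectivity_le_localConnectivity hxy).trans_lt (localConnectivity_lt_card hxy)

theorem exists_localConnectivity_le_vertexConnectivity :
    ∃ x y : V, x ≠ y ∧ G.localConnectivity x y ≤ G.vertexConnectivity := by
  by_contra! h
  have : G.IsVertexConnected (G.vertexConnectivity + 1) := ⟨inferInstance, h⟩
  have := le_csSup G.bddAbove_isVertexConnected this
  exact absurd this (Nat.not_succ_le_self _)

theorem vertexConnectivity_le_of_not_preconnected {S : Finset V}
    (h : ¬ (G.induce (S : Set V)ᶜ).Preconnected) : G.vertexConnectivity ≤ S.card := by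
  simp only [Preconnected, not_forall] at h
  obtain ⟨⟨x, hx⟩, ⟨y, hy⟩, hxy⟩ := h
  have hne : x ≠ y := by
    rintro rfl
    exact hxy (Reachable.refl _)
  refine (G.vertexConnectivity_le_localConnectivity hne).trans <| localConnectivity_le fun P hP =>
    card_le_of_pairwise_internallyDisjoint hP fun p _ => ?_
  by_contra! hS
  refine hxy ⟨p.1.induce (S : Set V)ᶜ fun v hv hvS => ?_⟩
  by_cases hvx : v = x
  · exact hx (hvx ▸ hvS)
  · exact hy (hS v hvS hv hvx ▸ hvS)

end Nontrivial

/-- `S` separates the nonempty sets `A` and `B` in the subgraph that `A ∪ B ∪ S` induces. -/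
structure IsSeparation (G : SimpleGraph V) (A B S : Finset V) : Prop where
  left_nonempty : A.Nonempty
  right_nonempty : B.Nonempty
  disjoint : Disjoint A B
  disjoint_left : Disjoint A S
  disjoint_right : Disjoint B S
  not_adj : ∀ a ∈ A, ∀ b ∈ B, ¬ G.Adj a b

theorem IsSeparation.symm {A B S : Finset V} (h : G.IsSeparation A B S) : G.IsSeparation B A S :=
  ⟨h.2, h.1, h.3.symm, h.5, h.4, fun a ha b hb hab => h.6 b hb a ha hab.symm⟩

theorem exists_path_support_eq {x y : V} {l : List V} (hne : l ≠ []) (hl : l.IsChain G.Adj)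
    (hn : l.Nodup) (hx : l.head? = some x) (hy : l.getLast? = some y) :
    ∃ p : G.Path x y, p.1.support = l := by
  have hx' : l.head hne = x := by simpa [List.head?_eq_some_head hne] using hx
  have hy' : l.getLast hne = y := by simpa [List.getLast?_eq_some_getLast hne] using hy
  refine ⟨⟨(Walk.ofSupport l hne hl).copy hx' hy', ?_⟩, ?_⟩
  · rw [Walk.isPath_def]
    simpa using hn
  · simp

open Classical in
/-- Disjoint paths between the neighbourhoods of `x` and `y`, together with the edge between `x`
and `y` if there is one, are internally disjoint paths from `x` to `y`. -/
theorem le_localConnectivity_of_hasLinkage [Fintype V] {x y : V} (hxy : x ≠ y) {k : ℕ}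
    (h : HasLinkage (Finset.univ.filter fun e : V × V => G.Adj e.1 e.2 ∧ e.2 ≠ x ∧ e.2 ≠ y)
      (Finset.univ.filter fun v => G.Adj x v ∧ v ≠ y)
      (Finset.univ.filter fun v => G.Adj v y ∧ v ≠ x) k) :
    k + (if G.Adj x y then 1 else 0) ≤ G.localConnectivity x y := by
  obtain ⟨I, p, rfl, hp, hd⟩ := h
  have hne : ∀ i ∈ I, p i ≠ [] := by
    intro i hi h
    obtain ⟨a, -, ha⟩ := (hp i hi).2.2.1
    simp [h] at ha
  have havoid : ∀ i ∈ I, ∀ v ∈ p i, v ≠ x ∧ v ≠ y := by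
    intro i hi
    obtain ⟨hc, -, ⟨a, ha, hpa⟩, -⟩ := hp i hi
    have key : ∀ (l : List V) (a : V), l.IsChain (fun a b => G.Adj a b ∧ b ≠ x ∧ b ≠ y) →
        l.head? = some a → a ≠ x ∧ a ≠ y → ∀ v ∈ l, v ≠ x ∧ v ≠ y := by
      intro l
      induction l with
      | nil => simp
      | cons b l ih =>
        intro a hl hb ha v hv
        obtain rfl : b = a := by simpa using hb
        rcases List.mem_cons.1 hv with rfl | hv
        · exact ha
        · cases l with
          | nil => simp at hv
          | cons c l =>
            rw [List.isChain_cons_cons] at hl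
            exact ih c hl.2 rfl hl.1.2 v hv
    simp only [Finset.mem_filter, Finset.mem_univ, true_and] at hc ha
    exact key (p i) a hc hpa ⟨ha.1.ne', ha.2⟩
  have hpath : ∀ i ∈ I, ∃ q : G.Path x y, q.1.support = x :: p i ++ [y] := by
    intro i hi
    obtain ⟨hc, hn, ⟨a, ha, hpa⟩, b, hb, hpb⟩ := hp i hi
    simp only [Finset.mem_filter, Finset.mem_univ, true_and] at hc ha hb
    refine exists_path_support_eq (by simp) ?_ ?_ (by simp)
      (List.getLast?_concat ..)
    · refine List.isChain_append.2 ⟨List.isChain_cons.2 ⟨?_, hc.imp fun _ _ h => h.1⟩, by simp, ?_⟩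
      · simpa [hpa] using ha.1
      · simpa [List.getLast?_cons, hpb] using hb.1
    · have hx := fun h => (havoid i hi x h).1 rfl
      refine List.nodup_append.2 ⟨List.nodup_cons.2 ⟨hx, hn⟩, by simp, ?_⟩
      rintro v hv w hw rfl
      obtain rfl := List.mem_singleton.1 hw
      rcases List.mem_cons.1 hv with rfl | hv
      · exact hxy rfl
      · exact (havoid i hi v hv).2 rfl
  choose q hq using fun i : I => hpath i.1 i.2
  have hqne : ∀ i j : I, i ≠ j → InternallyDisjoint (q i) (q j) := by
    intro i j hij v hv hv'
    rw [hq i] at hv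
    rw [hq j] at hv'
    have := @hd i i.2 j j.2 (fun h => hij (Subtype.ext h)) v
    simp only [List.cons_append, List.mem_cons, List.mem_append, List.not_mem_nil, or_false]
      at hv hv'
    tauto
  have hinner : ∀ i : I, ∃ v ∈ (q i).1.support, v ≠ x ∧ v ≠ y := by
    intro i
    obtain ⟨v, hv⟩ := List.exists_mem_of_ne_nil _ (hne i i.2)
    exact ⟨v, by simp [hq i, hv], havoid i i.2 v hv⟩
  have hinj : Function.Injective q := by
    intro i j hij
    by_contra hne'
    obtain ⟨v, hv, hvx, hvy⟩ := hinner i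
    exact (hqne i j hne' v hv (hij ▸ hv)).elim hvx hvy
  have hpair : ((Finset.univ.image q : Finset (G.Path x y)) : Set (G.Path x y)).Pairwise
      InternallyDisjoint := by
    rintro _ h _ h' hne'
    obtain ⟨i, -, rfl⟩ := Finset.mem_image.1 h
    obtain ⟨j, -, rfl⟩ := Finset.mem_image.1 h'
    exact hqne i j fun h => hne' (h ▸ rfl)
  have hcard : (Finset.univ.image q).card = I.card := by
    rw [Finset.card_image_of_injective _ hinj, Finset.card_univ, Fintype.card_coe]
  by_cases hadj : G.Adj x y
  · have hnot : Path.singleton hadj ∉ Finset.univ.image q := by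
      intro h
      obtain ⟨i, -, hqi⟩ := Finset.mem_image.1 h
      obtain ⟨v, hv, hvx, hvy⟩ := hinner i
      rw [hqi] at hv
      have : v = x ∨ v = y := by simpa [Path.singleton] using hv
      exact this.elim hvx hvy
    rw [if_pos hadj, ← hcard, ← Finset.card_insert_of_notMem hnot]
    refine card_le_localConnectivity hxy ?_
    rw [Finset.coe_insert]
    refine hpair.insert fun r _ _ => ⟨fun v hv _ => ?_, fun v _ hv => ?_⟩ <;>
    simpa [Path.singleton] using hv
  · rw [if_neg hadj, add_zero, ← hcard]
    exact card_le_localConnectivity hxy hpair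

open Classical in
/-- Menger's theorem for a pair of vertices that may be adjacent. -/
theorem exists_isSeparation_of_localConnectivity_le [Fintype V] {x y : V} (hxy : x ≠ y) {k : ℕ}
    (hk : G.localConnectivity x y ≤ k) (hkn : k + 2 ≤ Fintype.card V) :
    ∃ A B S : Finset V, G.IsSeparation A B S ∧ A ∪ B ∪ S = Finset.univ ∧ S.card ≤ k := by
  set d := if G.Adj x y then 1 else 0 with hd
  obtain ⟨T, ⟨R, hA, hE, hB⟩, hT⟩ : ∃ T, ArcSeparates
      (Finset.univ.filter fun e : V × V => G.Adj e.1 e.2 ∧ e.2 ≠ x ∧ e.2 ≠ y)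
      (Finset.univ.filter fun v => G.Adj x v ∧ v ≠ y)
      (Finset.univ.filter fun v => G.Adj v y ∧ v ≠ x) T ∧ T.card < k + 1 - d := by
    by_contra! h
    have := le_localConnectivity_of_hasLinkage hxy (hasLinkage_of_forall_arcSeparates _ _ _ _ h)
    split_ifs at hd this <;> omega
  simp only [Finset.mem_filter, Finset.mem_univ, true_and] at hA hE hB
  -- `x` lies in `A`, `y` lies in `B`, and only these two may be adjacent.
  set S := T \ {x, y} with hS
  set A := Finset.univ.filter fun v => v = x ∨ v ∈ R ∧ v ∉ T ∧ v ≠ y with hA'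
  set B := Finset.univ.filter fun v => v ∉ A ∧ v ∉ S with hB'
  have hSc : S.card ≤ T.card := Finset.card_le_card Finset.sdiff_subset
  have hAB : ∀ a ∈ A, ∀ b ∈ B, G.Adj a b → a = x ∧ b = y := by
    intro a ha b hb hab
    have := hA b
    have := hE a b
    have := hB a
    have := hab.symm
    grind
  have hxA : x ∈ A := by simp [hA']
  have hyB : y ∈ B := by simp [hB', hA', hS, hxy.symm]
  have h₁ : Disjoint A B := Finset.disjoint_left.2 fun v hv hv' => by grind
  have h₂ : Disjoint A S := Finset.disjoint_left.2 fun v hv hv' => by grind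
  have h₃ : Disjoint B S := Finset.disjoint_left.2 fun v hv hv' => by grind
  have hun : A ∪ B ∪ S = Finset.univ := by
    ext v
    grind
  by_cases hadj : G.Adj x y
  · simp only [hadj, if_true] at hd
    have hcard : A.card + B.card + S.card = Fintype.card V := by
      rw [← Finset.card_univ, ← hun, Finset.card_union_of_disjoint, Finset.card_union_of_disjoint h₁]
      exact Finset.disjoint_union_left.2 ⟨h₂, h₃⟩
    -- One of `A` and `B` has a second vertex, so `x` or `y` can be moved to the separator.
    by_cases hA1 : 2 ≤ A.card
    · refine ⟨A.erase x, B, insert x S, ⟨?_, ⟨y, hyB⟩, ?_, ?_, ?_, ?_⟩, ?_, ?_⟩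
      · rw [← Finset.card_pos, Finset.card_erase_of_mem hxA]
        omega
      · exact h₁.mono_left (Finset.erase_subset _ _)
      · rw [Finset.disjoint_left] at *
        grind
      · rw [Finset.disjoint_left] at *
        grind
      · intro a ha b hb hab
        exact (Finset.mem_erase.1 ha).1 (hAB a (Finset.mem_of_mem_erase ha) b hb hab).1
      · rw [← hun]
        ext v
        grind
      · have := Finset.card_insert_le x S
        omega
    · refine ⟨A, B.erase y, insert y S, ⟨⟨x, hxA⟩, ?_, ?_, ?_, ?_, ?_⟩, ?_, ?_⟩
      · rw [← Finset.card_pos, Finset.card_erase_of_mem hyB]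
        omega
      · exact h₁.mono_right (Finset.erase_subset _ _)
      · rw [Finset.disjoint_left] at *
        grind
      · rw [Finset.disjoint_left] at *
        grind
      · intro a ha b hb hab
        exact (Finset.mem_erase.1 hb).1 (hAB a ha b (Finset.mem_of_mem_erase hb) hab).2
      · rw [← hun]
        ext v
        grind
      · have := Finset.card_insert_le y S
        omega
  · exact ⟨A, B, S, ⟨⟨x, hxA⟩, ⟨y, hyB⟩, h₁, h₂, h₃, fun a ha b hb hab => by
      obtain ⟨rfl, rfl⟩ := hAB a ha b hb hab
      exact hadj hab⟩, hun, by omega⟩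

/-- Whitney's theorem: unless `κ(G) = |V| - 1`, some set of at most `κ(G)` vertices
separates `G`. -/
theorem exists_isSeparation_card_le_vertexConnectivity [Fintype V] [Nontrivial V] [DecidableEq V]
    (G : SimpleGraph V) (h : G.vertexConnectivity + 2 ≤ Fintype.card V) :
    ∃ A B S : Finset V, G.IsSeparation A B S ∧ A ∪ B ∪ S = Finset.univ ∧
      S.card ≤ G.vertexConnectivity := by
  obtain ⟨x, y, hxy, hle⟩ := G.exists_localConnectivity_le_vertexConnectivity
  convert exists_isSeparation_of_localConnectivity_le hxy hle h

end Connectivity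

/-! ### Removing copies of `K_{1,2}` from a separated graph -/

section Packing

variable {V : Type*} {G : SimpleGraph V}

theorem exists_subgraph_iso_K12 {c a b : V} (hca : G.Adj c a) (hcb : G.Adj c b) (hab : a ≠ b) :
    ∃ K : G.Subgraph, K.verts = {c, a, b} ∧ Nonempty (K.coe ≃g K12) := by
  let f : K12 →g G := ⟨Sum.elim (fun _ => c) ![a, b], by
    rintro (i | i) (j | j) h
    · simp at h
    · fin_cases j <;> simpa
    · fin_cases i <;> simpa [adj_comm]
    · simp at h⟩
  have hf : Function.Injective f := by
    have := hca.ne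
    have := hcb.ne
    rintro (i | i) (j | j) h <;> fin_cases i <;> fin_cases j <;> simp_all [f, eq_comm]
  let φ : Copy K12 G := ⟨f, hf⟩
  refine ⟨φ.toSubgraph, ?_, ⟨φ.isoToSubgraph.symm⟩⟩
  ext v
  simp [Copy.toSubgraph, φ, f, eq_comm]
  tauto

theorem exists_verts_eq_of_iso_K12 {K : G.Subgraph} (e : K.coe ≃g K12) :
    ∃ c a b, G.Adj c a ∧ G.Adj c b ∧ a ≠ b ∧ K.verts = {c, a, b} := by
  have hadj : ∀ i : Fin 2, G.Adj (e.symm (Sum.inl 0)).1 (e.symm (Sum.inr i)).1 := fun i =>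
    K.adj_sub (e.symm.map_rel_iff.2 (by simp))
  refine ⟨_, _, _, hadj 0, hadj 1, fun h => ?_, ?_⟩
  · have := e.symm.injective (Subtype.ext h)
    simp at this
  · ext v
    constructor
    · intro hv
      obtain ⟨u, hu⟩ := e.symm.surjective ⟨v, hv⟩
      obtain rfl : (e.symm u).1 = v := by rw [hu]
      rcases u with i | i <;> fin_cases i <;> simp
    · rintro (rfl | rfl | rfl) <;> exact Subtype.property _

theorem connected_K12 : K12.Connected := by
  refine ⟨fun u v => ?_⟩
  have key : ∀ u, K12.Reachable (Sum.inl 0) u := by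
    rintro (i | i)
    · fin_cases i
      exact Reachable.refl _
    · exact Adj.reachable (by simp)
  exact (key u).symm.trans (key v)

theorem isStructureCut_K12 {F : Finset G.Subgraph} (hiso : ∀ K ∈ F, Nonempty (K.coe ≃g K12))
    (hdis : (F : Set G.Subgraph).PairwiseDisjoint Subgraph.verts)
    (hcut : ¬ (G.induce (⋃ K ∈ F, K.verts)ᶜ).Preconnected ∨ (⋃ K ∈ F, K.verts)ᶜ.ncard = 1) :
    G.IsStructureCut K12 F := by
  refine ⟨⟨fun K hK => ?_, hdis, hcut⟩, hiso⟩
  obtain ⟨e⟩ := hiso K hK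
  exact Subgraph.connected_iff'.2 (e.connected_iff.2 connected_K12)

variable [DecidableEq V]

/-- Given a vertex `s` of the separator `S`, either `S \ {s}` already separates the same set of
vertices, or there is a copy of `K_{1,2}` through `s` that exhausts neither side. -/
theorem IsSeparation.exists_erase_or_exists_star {A B S : Finset V} (h : G.IsSeparation A B S)
    {s : V} (hs : s ∈ S) (hcard : 4 ≤ A.card + B.card) :
    (∃ A' B', G.IsSeparation A' B' (S.erase s) ∧ A' ∪ B' = insert s (A ∪ B)) ∨
    ∃ c a b, G.Adj c a ∧ G.Adj c b ∧ a ≠ b ∧ s ∈ ({c, a, b} : Finset V) ∧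
      ({c, a, b} : Finset V) ⊆ A ∪ B ∪ S ∧ (A \ {c, a, b}).Nonempty ∧
      (B \ {c, a, b}).Nonempty := by
  wlog hle : A.card ≤ B.card generalizing A B
  · rcases this h.symm (by omega) (by omega) with
      ⟨A', B', h', hun⟩ | ⟨c, a, b, h₁, h₂, h₃, h₄, h₅, h₆, h₇⟩
    · exact Or.inl ⟨A', B', h', by rw [hun, Finset.union_comm A B]⟩
    · exact Or.inr ⟨c, a, b, h₁, h₂, h₃, h₄, by rwa [Finset.union_comm A B], h₇, h₆⟩
  obtain ⟨hA, hB, hAB, hAS, hBS, hadj⟩ := h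
  have hAB' := Finset.disjoint_left.1 hAB
  have hAS' := Finset.disjoint_left.1 hAS
  have hBS' := Finset.disjoint_left.1 hBS
  by_cases hsA : ∀ a ∈ A, ¬ G.Adj s a
  · refine Or.inl ⟨A, insert s B, ⟨hA, by simp, ?_, ?_, ?_, ?_⟩, by grind⟩
    · rw [Finset.disjoint_left]; grind
    · rw [Finset.disjoint_left]; grind
    · rw [Finset.disjoint_left]; grind
    · intro a ha b hb
      rcases Finset.mem_insert.1 hb with rfl | hb
      · exact fun h => hsA a ha h.symm
      · exact hadj a ha b hb
  by_cases hsB : ∀ b ∈ B, ¬ G.Adj s b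
  · refine Or.inl ⟨insert s A, B, ⟨by simp, hB, ?_, ?_, ?_, ?_⟩, by grind⟩
    · rw [Finset.disjoint_left]; grind
    · rw [Finset.disjoint_left]; grind
    · rw [Finset.disjoint_left]; grind
    · intro a ha b hb
      rcases Finset.mem_insert.1 ha with rfl | ha
      · exact hsB b hb
      · exact hadj a ha b hb
  push Not at hsA hsB
  obtain ⟨a, ha, hsa⟩ := hsA
  obtain ⟨b, hb, hsb⟩ := hsB
  have hrest : ∀ {X T : Finset V}, (X ∩ T).card < X.card → (X \ T).Nonempty := by
    intro X T h
    rw [← Finset.card_pos, Finset.card_sdiff, Finset.inter_comm]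
    omega
  by_cases hA2 : 2 ≤ A.card
  · refine Or.inr ⟨s, a, b, hsa, hsb, fun h => hAB' ha (h ▸ hb), by simp, by grind, ?_, ?_⟩
    · refine hrest (lt_of_le_of_lt (Finset.card_le_card (t := {a}) ?_) (by rwa [Finset.card_singleton]))
      grind
    · refine hrest (lt_of_le_of_lt (Finset.card_le_card (t := {b}) ?_) ?_)
      · grind
      · rw [Finset.card_singleton]; omega
  -- Now `A` is a single vertex, and the star is chosen outside of it.
  by_cases hb' : ∃ b' ∈ B, b' ≠ b ∧ G.Adj s b'
  · obtain ⟨b', hb', hne, hsb'⟩ := hb'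
    refine Or.inr ⟨s, b, b', hsb, hsb', hne.symm, by simp, by grind, ?_, ?_⟩
    · refine hA.imp fun v hv => ?_
      grind
    · refine hrest (lt_of_le_of_lt (Finset.card_le_card (t := {b, b'}) ?_) ?_)
      · grind
      · have := Finset.card_le_two (a := b) (b := b'); omega
  by_cases hb'' : ∃ b' ∈ B, G.Adj b b'
  · obtain ⟨b', hb', hbb'⟩ := hb''
    refine Or.inr ⟨b, s, b', hsb.symm, hbb', fun h => hBS' hb' (h ▸ hs), by simp, by grind, ?_, ?_⟩
    · refine hA.imp fun v hv => ?_
      grind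
    · refine hrest (lt_of_le_of_lt (Finset.card_le_card (t := {b, b'}) ?_) ?_)
      · grind
      · have := Finset.card_le_two (a := b) (b := b'); omega
  -- `b` is isolated in `B` and the only neighbour of `s` there, so both can move to `A`.
  push Not at hb' hb''
  refine Or.inl ⟨insert s (insert b A), B.erase b, ⟨by simp, ?_, ?_, ?_, ?_, ?_⟩, by grind⟩
  · rw [← Finset.card_pos, Finset.card_erase_of_mem hb]; omega
  · rw [Finset.disjoint_left]; grind
  · rw [Finset.disjoint_left]; grind
  · rw [Finset.disjoint_left]; grind
  · intro v hv w hw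
    have hw' := hw
    obtain ⟨hwb, hw⟩ := Finset.mem_erase.1 hw
    simp only [Finset.mem_insert] at hv
    rcases hv with rfl | rfl | hv
    · exact hb' w hw hwb
    · exact hb'' w (Finset.mem_of_mem_erase hw')
    · exact hadj v hv w hw

/-- If the sides of a separation `(A, B, S)` have at least `2|S| + 2` vertices together, then at most
`|S|` disjoint copies of `K_{1,2}` can be removed so that what is left falls into two nonempty parts
without edges between them. -/
theorem IsSeparation.exists_K12_packing (n : ℕ) : ∀ {A B S : Finset V}, G.IsSeparation A B S →
    S.card = n → 2 * n + 2 ≤ A.card + B.card →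
    ∃ (F : Finset G.Subgraph) (A' B' : Finset V), F.card ≤ n ∧
      (∀ K ∈ F, Nonempty (K.coe ≃g K12)) ∧ (F : Set G.Subgraph).PairwiseDisjoint Subgraph.verts ∧
      G.IsSeparation A' B' ∅ ∧ A' ∪ B' ⊆ A ∪ B ∪ S ∧
      (⋃ K ∈ F, K.verts) = (((A ∪ B ∪ S) \ (A' ∪ B') : Finset V) : Set V) := by
  classical
  induction n using Nat.strong_induction_on with
  | _ n ih =>
  intro A B S h hn hcard
  rcases S.eq_empty_or_nonempty with rfl | ⟨s, hs⟩
  · exact ⟨∅, A, B, by simp, by simp, by simp, h, by simp, by simp⟩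
  have hpos : 0 < S.card := Finset.card_pos.2 ⟨s, hs⟩
  have hABS : (A ∪ B ∪ S).card = A.card + B.card + S.card := by
    rw [Finset.card_union_of_disjoint (Finset.disjoint_union_left.2 ⟨h.4, h.5⟩),
      Finset.card_union_of_disjoint h.3]
  rcases h.exists_erase_or_exists_star hs (by omega) with
    ⟨A₁, B₁, h₁, hun⟩ | ⟨c, a, b, hca, hcb, hab, hsT, hT, hAT, hBT⟩
  · have hcs : (S.erase s).card = n - 1 := by rw [Finset.card_erase_of_mem hs, hn]
    have hun' : A₁ ∪ B₁ ∪ S.erase s = A ∪ B ∪ S := by grind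
    have hc₁ : A₁.card + B₁.card = A.card + B.card + 1 := by
      rw [← Finset.card_union_of_disjoint h₁.3, hun, Finset.card_insert_of_notMem,
        Finset.card_union_of_disjoint h.3]
      intro hsAB
      exact Finset.disjoint_left.1 (Finset.disjoint_union_left.2 ⟨h.4, h.5⟩) hsAB hs
    obtain ⟨F, A', B', hF, hiso, hdis, hsep, hsub, hcov⟩ :=
      ih (n - 1) (by omega) h₁ hcs (by omega)
    rw [hun'] at hsub hcov
    exact ⟨F, A', B', hF.trans (Nat.sub_le _ _), hiso, hdis, hsep, hsub, hcov⟩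
  · obtain ⟨K, hKv, hK⟩ := exists_subgraph_iso_K12 hca hcb hab
    set T : Finset V := {c, a, b} with hTdef
    have hKT : K.verts = (T : Set V) := by simp [hKv, hTdef]
    have hT3 : T.card ≤ 3 := Finset.card_le_three
    have hsep' : G.IsSeparation (A \ T) (B \ T) (S \ T) :=
      ⟨hAT, hBT, h.3.mono Finset.sdiff_subset Finset.sdiff_subset,
        h.4.mono Finset.sdiff_subset Finset.sdiff_subset,
        h.5.mono Finset.sdiff_subset Finset.sdiff_subset,
        fun v hv w hw => h.6 v (Finset.sdiff_subset hv) w (Finset.sdiff_subset hw)⟩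
    have hun' : A \ T ∪ B \ T ∪ S \ T = (A ∪ B ∪ S) \ T := by
      rw [Finset.union_sdiff_distrib, Finset.union_sdiff_distrib]
    have hcard' : (A \ T).card + (B \ T).card + (S \ T).card + 3 ≥ A.card + B.card + S.card := by
      rw [← hABS, ← Finset.card_union_of_disjoint hsep'.3, ← Finset.card_union_of_disjoint
        (Finset.disjoint_union_left.2 ⟨hsep'.4, hsep'.5⟩), hun', Finset.card_sdiff_of_subset hT]
      omega
    have hlt : (S \ T).card < S.card :=
      Finset.card_lt_card (Finset.ssubset_iff_subset_ne.2 ⟨Finset.sdiff_subset, fun heq => by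
        rw [← heq] at hs
        exact (Finset.mem_sdiff.1 hs).2 hsT⟩)
    obtain ⟨F, A', B', hF, hiso, hdis, hsep, hsub, hcov⟩ :=
      ih (S \ T).card (by omega) hsep' rfl (by omega)
    rw [hun'] at hsub hcov
    have hdisj : ∀ L ∈ F, Disjoint K.verts L.verts := by
      intro L hL
      have : L.verts ⊆ ⋃ K ∈ F, K.verts := Set.subset_biUnion_of_mem (u := Subgraph.verts) hL
      rw [hKT]
      refine Set.disjoint_left.2 fun v hv hvL => ?_
      have := hcov ▸ this hvL
      simp only [Finset.coe_sdiff, Set.mem_sdiff, Finset.mem_coe] at this hv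
      exact this.1.2 hv
    refine ⟨insert K F, A', B', ?_, ?_, ?_, hsep, hsub.trans Finset.sdiff_subset, ?_⟩
    · have := Finset.card_insert_le K F
      omega
    · intro L hL
      rcases Finset.mem_insert.1 hL with rfl | hL
      · exact hK
      · exact hiso L hL
    · rw [Finset.coe_insert]
      exact hdis.insert fun L hL _ => hdisj L hL
    · rw [Finset.set_biUnion_insert, hcov, hKT, ← Finset.coe_union]
      congr 1
      ext v
      have := @hT v
      have := @hsub v
      grind

theorem IsSeparation.not_preconnected {A B S : Finset V} (h : G.IsSeparation A B S) {W : Set V}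
    (hW : W = ((A ∪ B : Finset V) : Set V)) : ¬ (G.induce W).Preconnected := by
  subst hW
  intro hc
  obtain ⟨a, ha⟩ := h.left_nonempty
  obtain ⟨b, hb⟩ := h.right_nonempty
  have key : ∀ {u v : ((A ∪ B : Finset V) : Set V)}, (G.induce _).Walk u v →
      u.1 ∈ A → v.1 ∈ A := by
    intro u v p
    induction p with
    | nil => exact id
    | @cons u v w huv p ih =>
      intro hu
      refine ih (by_contra fun hv => ?_)
      have hvB : v.1 ∈ B := (Finset.mem_union.1 v.2).resolve_left hv
      exact h.not_adj _ hu _ hvB huv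
  obtain ⟨p⟩ := hc ⟨a, by simp [ha]⟩ ⟨b, by simp [hb]⟩
  exact Finset.disjoint_left.1 h.disjoint (key p ha) hb

theorem IsSeparation.exists_isStructureCut [Fintype V] {A B S : Finset V}
    (h : G.IsSeparation A B S) (hun : A ∪ B ∪ S = Finset.univ)
    (hcard : 3 * S.card + 2 ≤ Fintype.card V) :
    ∃ F : Finset G.Subgraph, G.IsStructureCut K12 F ∧ F.card ≤ S.card := by
  have hABS : (A ∪ B ∪ S).card = A.card + B.card + S.card := by
    rw [Finset.card_union_of_disjoint (Finset.disjoint_union_left.2 ⟨h.4, h.5⟩),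
      Finset.card_union_of_disjoint h.3]
  rw [hun, Finset.card_univ] at hABS
  obtain ⟨F, A', B', hF, hiso, hdis, hsep, -, hcov⟩ := h.exists_K12_packing _ rfl (by omega)
  refine ⟨F, isStructureCut_K12 hiso hdis (Or.inl (hsep.not_preconnected ?_)), hF⟩
  rw [hcov, hun, ← Finset.coe_compl]
  congr 1
  ext v
  simp [or_iff_not_imp_left]

end Packing

/-! ### Structure-connectivity and connectivity -/

section Bounds

variable {V : Type*} {G : SimpleGraph V}

theorem IsStructureCut.ncard_biUnion_verts [Finite V] {F : Finset G.Subgraph}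
    (hF : G.IsStructureCut K12 F) : (⋃ K ∈ F, K.verts).ncard = 3 * F.card := by
  have hK : ∀ K ∈ F, K.verts.ncard = 3 := by
    intro K hK
    obtain ⟨e⟩ := hF.2 K hK
    rw [← Nat.card_coe_set_eq, Nat.card_congr e.toEquiv]
    simp
  classical
  have := Fintype.ofFinite V
  have hun : (⋃ K ∈ F, K.verts) = ((F.biUnion fun K => K.verts.toFinset : Finset V) : Set V) := by
    simp
  rw [hun, Set.ncard_coe_finset, Finset.card_biUnion, Finset.sum_congr rfl (g := fun _ => 3),
    Finset.sum_const, smul_eq_mul, mul_comm]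
  · intro K h
    rw [← Set.ncard_eq_toFinset_card', hK K h]
  · intro K h L h' hne
    simpa using hF.1.2.1 h h' hne

theorem IsStructureCut.vertexConnectivity_le [Finite V] [Nontrivial V] {F : Finset G.Subgraph}
    (hF : G.IsStructureCut K12 F) : G.vertexConnectivity ≤ 3 * F.card := by
  classical
  have := Fintype.ofFinite V
  rw [← hF.ncard_biUnion_verts]
  rcases hF.1.2.2 with h | h
  · have := G.vertexConnectivity_le_of_not_preconnected (S := (⋃ K ∈ F, K.verts).toFinset)
      (by rwa [Set.coe_toFinset])
    rwa [← Set.ncard_eq_toFinset_card'] at this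
  · have h₁ := Set.ncard_add_ncard_compl (⋃ K ∈ F, K.verts)
    have h₂ := G.vertexConnectivity_lt_card
    omega

theorem IsStructureCut.structureConnectivity_le {W : Type*} {H : SimpleGraph W}
    {F : Finset G.Subgraph} (hF : G.IsStructureCut H F) : G.structureConnectivity H ≤ F.card :=
  Nat.sInf_le ⟨F, hF, rfl⟩

theorem exists_isStructureCut_card_eq {W : Type*} {H : SimpleGraph W}
    (h : ∃ F : Finset G.Subgraph, G.IsStructureCut H F) :
    ∃ F : Finset G.Subgraph, G.IsStructureCut H F ∧ F.card = G.structureConnectivity H := by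
  obtain ⟨F, hF⟩ := h
  exact Nat.sInf_mem (s := {k | ∃ F : Finset G.Subgraph, G.IsStructureCut H F ∧ F.card = k})
    ⟨_, F, hF, rfl⟩

theorem vertexConnectivity_le_three_mul_structureConnectivity [Finite V] [Nontrivial V]
    (h : ∃ F : Finset G.Subgraph, G.IsStructureCut K12 F) :
    G.vertexConnectivity ≤ 3 * G.structureConnectivity K12 := by
  obtain ⟨F, hF, hcard⟩ := exists_isStructureCut_card_eq h
  exact hcard ▸ hF.vertexConnectivity_le

/-- The existence of a structure-cut matters only if `|V| ≤ 3κ(G) + 3`; for larger graphs the proof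
constructs one. -/
theorem structureConnectivity_le_vertexConnectivity [Finite V] [Nontrivial V]
    (h : ∃ F : Finset G.Subgraph, G.IsStructureCut K12 F) :
    G.structureConnectivity K12 ≤ G.vertexConnectivity := by
  classical
  have := Fintype.ofFinite V
  by_cases hn : 3 * G.vertexConnectivity + 4 ≤ Fintype.card V
  · obtain ⟨A, B, S, hsep, hun, hS⟩ :=
      G.exists_isSeparation_card_le_vertexConnectivity (by omega)
    obtain ⟨F, hF, hcard⟩ := hsep.exists_isStructureCut hun (by omega)
    exact hF.structureConnectivity_le.trans (hcard.trans hS)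
  · -- A structure-cut leaves a vertex over, so it has at most `(|V| - 1) / 3` elements.
    obtain ⟨F, hF⟩ := h
    refine hF.structureConnectivity_le.trans ?_
    have h₁ := Set.ncard_add_ncard_compl (⋃ K ∈ F, K.verts)
    have h₂ : (⋃ K ∈ F, K.verts)ᶜ.ncard ≠ 0 := by
      rcases hF.1.2.2 with h | h
      · intro h0
        rw [Set.ncard_eq_zero] at h0
        exact h fun u => (Set.eq_empty_iff_forall_notMem.1 h0 u.1 u.2).elim
      · omega
    rw [hF.ncard_biUnion_verts, Nat.card_eq_fintype_card] at h₁
    omega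

end Bounds

/-! ### A graph that attains the lower bound -/

section CompleteMinusEdge

/-- `K_5` without an edge has connectivity three, and removing a path on the three vertices of full
degree leaves two isolated vertices. -/
theorem exists_structureConnectivity_eq_vertexConnectivity_div_three :
    ∃ (n : ℕ) (G : SimpleGraph (Fin n)), 4 ≤ n ∧ G.Connected ∧
      (∃ F : Finset G.Subgraph, G.IsStructureCut K12 F) ∧
      (G.structureConnectivity K12 : ℝ) = (G.vertexConnectivity : ℝ) / 3 := by
  let G : SimpleGraph (Fin 5) := (⊤ : SimpleGraph (Fin 5)).deleteEdges {s(3, 4)}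
  have hadj : ∀ u v : Fin 5, G.Adj u v ↔ u ≠ v ∧ s(u, v) ≠ s(3, 4) := by
    intro u v
    simp [G, deleteEdges_adj]
  have hconn : G.Connected := by
    have key : ∀ u, G.Reachable 0 u := by
      intro u
      by_cases hu : u = 0
      · exact hu ▸ Reachable.refl _
      · refine Adj.reachable ((hadj _ _).2 ⟨Ne.symm hu, ?_⟩)
        simp [Fin.ext_iff]
    exact ⟨fun u v => (key u).symm.trans (key v)⟩
  obtain ⟨K, hKv, hK⟩ := exists_subgraph_iso_K12 (G := G) (c := 0) (a := 1) (b := 2)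
    ((hadj _ _).2 (by simp)) ((hadj _ _).2 (by simp)) (by simp)
  have hsep : G.IsSeparation {3} {4} ∅ :=
    ⟨by simp, by simp, by simp, by simp, by simp, by simp [hadj]⟩
  have hcut : G.IsStructureCut K12 {K} := by
    refine isStructureCut_K12 (by simpa using hK) (by simp) (Or.inl (hsep.not_preconnected ?_))
    ext v
    simp only [Finset.mem_singleton, Set.iUnion_iUnion_eq_left, hKv]
    fin_cases v <;> simp
  have hlow : 3 ≤ G.vertexConnectivity := by
    by_contra! h
    obtain ⟨A, B, S, ⟨⟨a, ha⟩, ⟨b, hb⟩, hAB, hAS, hBS, hnot⟩, hun, hS⟩ :=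
      G.exists_isSeparation_card_le_vertexConnectivity (by simp; omega)
    have hpair : ∀ a ∈ A, ∀ b ∈ B, s(a, b) = s(3, 4) := by
      intro a ha b hb
      by_contra hne
      exact hnot a ha b hb ((hadj a b).2 ⟨fun h => Finset.disjoint_left.1 hAB ha (h ▸ hb), hne⟩)
    have hsub : A ∪ B ⊆ {3, 4} := by
      intro v hv
      have key : ∀ u w : Fin 5, s(u, w) = s(3, 4) → u ∈ ({3, 4} : Finset (Fin 5)) ∧
          w ∈ ({3, 4} : Finset (Fin 5)) := by decide
      rcases Finset.mem_union.1 hv with hv | hv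
      · exact (key v b (hpair v hv b hb)).1
      · exact (key a v (hpair a ha v hv)).2
    have h₁ := Finset.card_le_card hsub
    have h₂ := Finset.card_union_le (A ∪ B) S
    rw [hun] at h₂
    simp at h₁ h₂
    omega
  have h₁ := vertexConnectivity_le_three_mul_structureConnectivity ⟨_, hcut⟩
  have h₂ := hcut.structureConnectivity_le
  rw [Finset.card_singleton] at h₂
  have hs : G.structureConnectivity K12 = 1 := by omega
  have hk : G.vertexConnectivity = 3 := by omega
  exact ⟨5, G, by norm_num, hconn, ⟨_, hcut⟩, by rw [hs, hk]; norm_num⟩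

end CompleteMinusEdge

/-! ### Cycles -/

section Cycle

variable {n : ℕ}

theorem cycleGraph_adj_iff_val (hn : 2 ≤ n) {u v : Fin n} : (cycleGraph n).Adj u v ↔
    u.val + 1 = v.val ∨ v.val + 1 = u.val ∨ (u.val = 0 ∧ v.val + 1 = n) ∨
      (v.val = 0 ∧ u.val + 1 = n) := by
  have key : ∀ u v : Fin n, (u - v).val = 1 ↔ v.val + 1 = u.val ∨ (u.val = 0 ∧ v.val + 1 = n) := by
    intro u v
    rw [Fin.val_sub]
    have hu := u.2
    have hv := v.2
    rcases lt_or_ge u.val v.val with h | h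
    · rw [Nat.mod_eq_of_lt (by omega)]
      omega
    · rw [Nat.mod_eq_sub_mod (by omega), Nat.mod_eq_of_lt (by omega)]
      omega
  rw [cycleGraph_adj', key, key]
  tauto

theorem add_mod_cases {a i : ℕ} (h : a + i < 2 * n) :
    (a + i < n ∧ (a + i) % n = a + i) ∨ (n ≤ a + i ∧ (a + i) % n = a + i - n) := by
  rcases lt_or_ge (a + i) n with h' | h'
  · exact Or.inl ⟨h', Nat.mod_eq_of_lt h'⟩
  · exact Or.inr ⟨h', by rw [Nat.mod_eq_sub_mod h', Nat.mod_eq_of_lt (by omega)]⟩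

/-- Consecutive vertices of a cycle induce a connected subgraph. -/
theorem preconnected_induce_cycleGraph (hn : 2 ≤ n) {a m : ℕ} (ham : a + m ≤ 2 * n)
    {W : Set (Fin n)} (hW : ∀ v, v ∈ W ↔ ∃ i < m, v.val = (a + i) % n) :
    ((cycleGraph n).induce W).Preconnected := by
  have hpos : 0 < n := by omega
  have hmem : ∀ i < m, (⟨(a + i) % n, Nat.mod_lt _ hpos⟩ : Fin n) ∈ W := fun i hi =>
    (hW _).2 ⟨i, hi, rfl⟩
  have key : ∀ i, (hi : i < m) → ((cycleGraph n).induce W).Reachable ⟨_, hmem 0 (by omega)⟩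
      ⟨_, hmem i hi⟩ := by
    intro i
    induction i with
    | zero => exact fun _ => Reachable.refl _
    | succ i ih =>
      intro hi
      refine (ih (by omega)).trans (Adj.reachable ?_)
      rw [induce_adj, cycleGraph_adj_iff_val hn]
      have h₁ := add_mod_cases (n := n) (a := a) (i := i) (by omega)
      have h₂ := add_mod_cases (n := n) (a := a) (i := i + 1) (by omega)
      dsimp only
      omega
  have hall : ∀ u : W, ∃ i, ∃ hi : i < m, u = ⟨_, hmem i hi⟩ := by
    rintro ⟨u, hu⟩
    obtain ⟨i, hi, h⟩ := (hW u).1 hu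
    exact ⟨i, hi, Subtype.ext (Fin.ext h)⟩
  intro u v
  obtain ⟨i, hi, rfl⟩ := hall u
  obtain ⟨j, hj, rfl⟩ := hall v
  exact (key i hi).symm.trans (key j hj)

theorem preconnected_induce_univ_cycleGraph (hn : 2 ≤ n) {W : Set (Fin n)} (hW : W = Set.univ) :
    ((cycleGraph n).induce W).Preconnected := by
  refine preconnected_induce_cycleGraph hn (a := 0) (m := n) (by omega) fun v => ?_
  simp only [hW, Set.mem_univ, zero_add, true_iff]
  exact ⟨v, v.2, (Nat.mod_eq_of_lt v.2).symm⟩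

theorem vertexConnectivity_cycleGraph (hn : 4 ≤ n) : (cycleGraph n).vertexConnectivity = 2 := by
  have : Nontrivial (Fin n) := Fin.nontrivial_iff_two_le.2 (by omega)
  refine le_antisymm ?_ ?_
  · have hsep : (cycleGraph n).IsSeparation {⟨1, by omega⟩} (Finset.univ.filter fun v => 3 ≤ v.val)
        {⟨0, by omega⟩, ⟨2, by omega⟩} := by
      refine ⟨by simp, ⟨⟨3, by omega⟩, by simp⟩, by simp, by simp, by simp, ?_⟩
      intro a ha b hb
      simp only [Finset.mem_singleton] at ha
      simp only [Finset.mem_filter, Finset.mem_univ, true_and] at hb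
      rw [cycleGraph_adj_iff_val (by omega), ha]
      dsimp only
      omega
    refine (vertexConnectivity_le_of_not_preconnected (S := {⟨0, by omega⟩, ⟨2, by omega⟩}) _
      (hsep.not_preconnected ?_)).trans Finset.card_le_two
    ext v
    simp [Fin.ext_iff]
    omega
  · by_contra! h
    obtain ⟨A, B, S, hsep, hun, hS⟩ :=
      (cycleGraph n).exists_isSeparation_card_le_vertexConnectivity (by simp; omega)
    have hSc : (S : Set (Fin n))ᶜ = ((A ∪ B : Finset (Fin n)) : Set (Fin n)) := by
      have h₁ := Finset.disjoint_left.1 hsep.disjoint_left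
      have h₂ := Finset.disjoint_left.1 hsep.disjoint_right
      ext v
      have hv : v ∈ A ∪ B ∪ S := hun ▸ Finset.mem_univ v
      simp only [Set.mem_compl_iff, Finset.mem_coe]
      grind
    refine hsep.not_preconnected hSc ?_
    obtain ⟨s, hs⟩ := Finset.card_le_one_iff_subset_singleton.1 (show S.card ≤ 1 by omega)
    rcases Finset.subset_singleton_iff.1 hs with rfl | rfl
    · exact preconnected_induce_univ_cycleGraph (by omega) (by simp)
    · have hs := s.2
      refine preconnected_induce_cycleGraph (by omega) (a := s.val + 1) (m := n - 1) (by omega)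
        fun v => ?_
      have hv := v.2
      simp only [Finset.coe_singleton, Set.mem_compl_iff, Set.mem_singleton_iff, Fin.ext_iff]
      constructor
      · intro hne
        rcases lt_or_gt_of_ne hne with h | h
        · refine ⟨v.val + n - s.val - 1, by omega, ?_⟩
          have := add_mod_cases (n := n) (a := s.val + 1) (i := v.val + n - s.val - 1) (by omega)
          omega
        · refine ⟨v.val - s.val - 1, by omega, ?_⟩
          have := add_mod_cases (n := n) (a := s.val + 1) (i := v.val - s.val - 1) (by omega)
          omega
      · rintro ⟨i, hi, h⟩
        have := add_mod_cases (n := n) (a := s.val + 1) (i := i) (by omega)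
        omega

theorem exists_isStructureCut_cycleGraph (hn : 7 ≤ n) :
    ∃ F : Finset (cycleGraph n).Subgraph, (cycleGraph n).IsStructureCut K12 F := by
  classical
  have hadj : ∀ (u v : ℕ) (hu : u < n) (hv : v < n), u + 1 = v ∨ v + 1 = u →
      (cycleGraph n).Adj ⟨u, hu⟩ ⟨v, hv⟩ := by
    intro u v hu hv h
    rw [cycleGraph_adj_iff_val (by omega)]
    dsimp only
    omega
  obtain ⟨K, hKv, hK⟩ := exists_subgraph_iso_K12 (hadj 1 0 (by omega) (by omega) (by omega))
    (hadj 1 2 (by omega) (by omega) (by omega)) (by simp)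
  obtain ⟨L, hLv, hL⟩ := exists_subgraph_iso_K12 (hadj 5 4 (by omega) (by omega) (by omega))
    (hadj 5 6 (by omega) (by omega) (by omega)) (by simp)
  have hcov : ∀ v : Fin n, v ∈ (⋃ M ∈ ({K, L} : Finset (cycleGraph n).Subgraph), M.verts)ᶜ ↔
      v.val = 3 ∨ 7 ≤ v.val := by
    intro v
    simp [hKv, hLv, Fin.ext_iff]
    omega
  refine ⟨{K, L}, isStructureCut_K12 ?_ ?_ ?_⟩
  · simp [hK, hL]
  · rw [Finset.coe_pair]
    have hKL : Disjoint K.verts L.verts := by simp [hKv, hLv]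
    rintro M (rfl | rfl) N (rfl | rfl) hne
    · exact absurd rfl hne
    · exact hKL
    · exact hKL.symm
    · exact absurd rfl hne
  · rcases hn.eq_or_lt with rfl | hn
    · right
      rw [Set.ncard_eq_one]
      refine ⟨3, ?_⟩
      ext v
      rw [hcov, Set.mem_singleton_iff, Fin.ext_iff]
      have := v.2
      change _ ↔ v.val = 3
      omega
    · left
      have hsep : (cycleGraph n).IsSeparation {⟨3, by omega⟩}
          (Finset.univ.filter fun v => 7 ≤ v.val) ∅ := by
        refine ⟨by simp, ⟨⟨7, by omega⟩, by simp⟩, by simp, by simp, by simp, ?_⟩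
        intro a ha b hb
        simp only [Finset.mem_singleton] at ha
        simp only [Finset.mem_filter, Finset.mem_univ, true_and] at hb
        rw [cycleGraph_adj_iff_val (by omega), ha]
        dsimp only
        omega
      refine hsep.not_preconnected ?_
      ext v
      rw [hcov]
      simp [Fin.ext_iff]

/-- Removing one copy of `K_{1,2}` from a cycle leaves a path. -/
theorem two_le_structureConnectivity_cycleGraph (hn : 7 ≤ n) :
    2 ≤ (cycleGraph n).structureConnectivity K12 := by
  by_contra! h
  obtain ⟨F, hF, hcard⟩ := exists_isStructureCut_card_eq (exists_isStructureCut_cycleGraph hn)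
  have hncard := hF.ncard_biUnion_verts
  have hcompl := Set.ncard_add_ncard_compl (⋃ K ∈ F, K.verts)
  rw [Nat.card_eq_fintype_card, Fintype.card_fin] at hcompl
  refine (hF.1.2.2.resolve_right (by omega)) ?_
  rcases Nat.eq_zero_or_pos F.card with h0 | h0
  · rw [Finset.card_eq_zero] at h0
    exact preconnected_induce_univ_cycleGraph (by omega) (by simp [h0])
  · obtain ⟨K, rfl⟩ := Finset.card_eq_one.1 (show F.card = 1 by omega)
    obtain ⟨e⟩ := hF.2 K (by simp)
    obtain ⟨c, a, b, hca, hcb, hab, hK⟩ := exists_verts_eq_of_iso_K12 e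
    rw [cycleGraph_adj_iff_val (by omega)] at hca hcb
    have ha := a.2
    have hb := b.2
    have hc := c.2
    rw [Ne, Fin.ext_iff] at hab
    refine preconnected_induce_cycleGraph (by omega) (a := c.val + 2) (m := n - 3) (by omega)
      fun v => ?_
    have hv := v.2
    simp only [Finset.mem_singleton, Set.iUnion_iUnion_eq_left, hK, Set.mem_compl_iff,
      Set.mem_insert_iff, Set.mem_singleton_iff, Fin.ext_iff]
    constructor
    · intro hne
      rcases lt_or_ge v.val (c.val + 2) with h | h
      · refine ⟨v.val + n - c.val - 2, by omega, ?_⟩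
        have := add_mod_cases (n := n) (a := c.val + 2) (i := v.val + n - c.val - 2) (by omega)
        omega
      · refine ⟨v.val - c.val - 2, by omega, ?_⟩
        have := add_mod_cases (n := n) (a := c.val + 2) (i := v.val - c.val - 2) (by omega)
        omega
    · rintro ⟨i, hi, h⟩
      have := add_mod_cases (n := n) (a := c.val + 2) (i := i) (by omega)
      omega

end Cycle

end SimpleGraph

theorem theorem4p2 :
    -- the two bounds
    (∀ (V : Type*) [Finite V] (G : SimpleGraph V), G.Connected → 4 ≤ Nat.card V →
      (∃ F : Finset G.Subgraph, G.IsStructureCut SimpleGraph.K12 F) →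
      (G.vertexConnectivity : ℝ) / 3 ≤ (G.structureConnectivity SimpleGraph.K12 : ℝ) ∧
      G.structureConnectivity SimpleGraph.K12 ≤ G.vertexConnectivity) ∧
    -- the lower bound is attained
    (∃ (n : ℕ) (G : SimpleGraph (Fin n)), 4 ≤ n ∧ G.Connected ∧
      (∃ F : Finset G.Subgraph, G.IsStructureCut SimpleGraph.K12 F) ∧
      (G.structureConnectivity SimpleGraph.K12 : ℝ) = (G.vertexConnectivity : ℝ) / 3) ∧
    -- the upper bound is attained by every cycle of length at least seven
    (∀ n : ℕ, 7 ≤ n → (SimpleGraph.cycleGraph n).Connected ∧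
      (∃ F : Finset (SimpleGraph.cycleGraph n).Subgraph,
        (SimpleGraph.cycleGraph n).IsStructureCut SimpleGraph.K12 F) ∧
      (SimpleGraph.cycleGraph n).structureConnectivity SimpleGraph.K12 = 2 ∧
      (SimpleGraph.cycleGraph n).vertexConnectivity = 2) := by
  refine ⟨fun V _ G _ hV h => ?_,
    SimpleGraph.exists_structureConnectivity_eq_vertexConnectivity_div_three, fun n hn => ?_⟩
  · have : Nontrivial V := Finite.one_lt_card_iff_nontrivial.1 (by omega)
    refine ⟨?_, SimpleGraph.structureConnectivity_le_vertexConnectivity h⟩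
    rw [div_le_iff₀ (by norm_num), mul_comm]
    exact_mod_cast SimpleGraph.vertexConnectivity_le_three_mul_structureConnectivity h
  · have : Nontrivial (Fin n) := Fin.nontrivial_iff_two_le.2 (by omega)
    have hcut := SimpleGraph.exists_isStructureCut_cycleGraph hn
    have hk := SimpleGraph.vertexConnectivity_cycleGraph (n := n) (by omega)
    refine ⟨?_, hcut, le_antisymm ?_ (SimpleGraph.two_le_structureConnectivity_cycleGraph hn), hk⟩
    · obtain ⟨m, rfl⟩ : ∃ m, n = m + 1 := ⟨n - 1, by omega⟩
      exact SimpleGraph.cycleGraph_connected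
    · exact (SimpleGraph.structureConnectivity_le_vertexConnectivity hcut).trans hk.le
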